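/- Fix constants $D,d>0$ and let $\Theta=\Theta(D,d)$ be the set of pairs $(\sigma,b)$ of real functions on $[0,1]$ such that $b',\sigma',\sigma''$ exist on $[0,1]$ (one-sided at the end points), $b(0)=b(1)=\sigma'(0)=\sigma'(1)=0$, $\max(\|b\|_\infty,\|b'\|_\infty,\|\sigma\|_\infty,\|\sigma'\|_\infty,\|\sigma''\|_\infty)\le D$ and $\inf_{x\in[0,1]}\sigma^2(x)\ge d$. For $(\sigma,b)\in\Theta$ set $$G_{\sigma b}=\int_0^1\frac1{\sigma^2(y)}\exp\Big(\int_0^y\frac{2b(v)}{\sigma^2(v)}\,dv\Big)dy,\qquad \mu_{\sigma b}(x)=\frac1{G_{\sigma b}\,\sigma^2(x)}\exp\Big(\int_0^x\frac{2b(v)}{\sigma^2(v)}\,dv\Big),$$ the invariant density of the diffusion $dX_t=b(X_t)\,dt+\sigma(X_t)\,dW_t$ on $[0,1]$ reflected at $0$ and $1$. For $(\sigma,b),(\sigma_0,b_0)\in\Theta$ write $\mu_0=\mu_{\sigma_0b_0}$ and define, for $x,z\in[0,1]$, $$H_{\sigma b}(x,z)=\int_0^1\Big(\mathbf 1_{[z,x]}(y)-\mathbf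 1_{[z,1]}(y)\int_y^1\mu_0(u)\,du\Big)\exp\Big(-\int_0^y\frac{2b(v)}{\sigma^2(v)}\,dv\Big)dy\;\frac{\mu_{\sigma b}(z)}{\mu_0(z)},$$ $$K_{\sigma b}(x,z)=2G_{\sigma b}\Big(H_{\sigma b}(x,z)-\frac{\mu_{\sigma b}(z)}{\mu_0(z)}\int_0^1H_{\sigma b}(x,y)\mu_0(y)\,dy\Big),$$ where $[z,x]=\emptyset$ if $x<z$, and let $H_{\sigma_0b_0},K_{\sigma_0b_0}$ be given by the same formulas, with the same $\mu_0$, for $(\sigma_0,b_0)$ in place of $(\sigma,b)$. (The kernel $K_{\sigma b}$ is the Green kernel, with respect to $\mu_0(z)\,dz$, of the inverse of the centred generator $L_{\sigma b}-\mu_0(L_{\sigma b})$ on $\{f\in L^2(\mu_0):\int f\,d\mu_0=0\}$.) For $s>0$ let $\|g\|_{B^s_{1\infty}}=\|g\|_{L^1([0,1])}+\sup_{t>0}t^{-s}\sup_{0<h\le t}\|\Delta_h^rg\|_{L^1([0,1-rh])}$, where $r$ is the least integer larger than $s$ and $\Delta_hg(x)=g(x+h)-g(x)$ (an $L^1$-norm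 over an empty set is $0$), and for bounded measurable $f$ let $$\|f\|_{(B^s_{1\infty})^*}=\sup_{\|g\|_{B^s_{1\infty}}\le1}\Big|\int_0^1f(x)g(x)\,dx\Big|.$$ Then there exists a constant $\tilde C>0$, depending only on $D$ and $d$, such that for all $(\sigma,b),(\sigma_0,b_0)\in\Theta$ $$\Big(\int_0^1\!\int_0^1\big(K_{\sigma b}-K_{\sigma_0b_0}\big)^2(x,z)\,\mu_0(x)\mu_0(z)\,dx\,dz\Big)^{1/2}\le\tilde C\,\|\mu_{\sigma b}-\mu_0\|_{L^2([0,1])}+\tilde C\,\Big\|\frac1{\sigma^2}-\frac1{\sigma_0^2}\Big\|_{(B^1_{1\infty})^*}+\tilde C\,\|b-b_0\|_{(B^2_{1\infty})^*}.$$ -/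

import Mathlib

open MeasureTheory Set
open scoped ENNReal NNReal

noncomputable section

namespace ReflectedDiffusion

/-! Functions on `[0,1]` are represented by functions `ℝ → ℝ`; every definition below uses only
their values on `[0,1]`. Derivatives on `[0,1]` are `derivWithin · (Icc 0 1)`, one-sided at the end
points. -/

/-- The parameter class `Θ = Θ(D, d)` of pairs `(σ, b)`. -/
def Theta (D d : ℝ) : Set ((ℝ → ℝ) × (ℝ → ℝ)) :=
  {θ | DifferentiableOn ℝ θ.2 (Icc 0 1) ∧
    DifferentiableOn ℝ θ.1 (Icc 0 1) ∧
    DifferentiableOn ℝ (derivWithin θ.1 (Icc 0 1)) (Icc 0 1) ∧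
    θ.2 0 = 0 ∧ θ.2 1 = 0 ∧
    derivWithin θ.1 (Icc 0 1) 0 = 0 ∧ derivWithin θ.1 (Icc 0 1) 1 = 0 ∧
    (∀ x ∈ Icc (0 : ℝ) 1,
      |θ.2 x| ≤ D ∧ |derivWithin θ.2 (Icc 0 1) x| ≤ D ∧
      |θ.1 x| ≤ D ∧ |derivWithin θ.1 (Icc 0 1) x| ≤ D ∧
      |derivWithin (derivWithin θ.1 (Icc 0 1)) (Icc 0 1) x| ≤ D) ∧
    (∀ x ∈ Icc (0 : ℝ) 1, d ≤ θ.1 x ^ 2)}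

/-- The exponent `∫₀ˣ 2 b(y) / σ²(y) dy`. -/
def driftExponent (σ b : ℝ → ℝ) (x : ℝ) : ℝ :=
  ∫ y in (0 : ℝ)..x, 2 * b y / σ y ^ 2

/-- The normalising constant `G_{σb}`. -/
def normConst (σ b : ℝ → ℝ) : ℝ :=
  ∫ y in (0 : ℝ)..1, 1 / σ y ^ 2 * Real.exp (driftExponent σ b y)

/-- The invariant density `μ_{σb}`. -/
def invDensity (σ b : ℝ → ℝ) (x : ℝ) : ℝ :=
  1 / (normConst σ b * σ x ^ 2) * Real.exp (driftExponent σ b x)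

/-- The function `H_{σb}(x, z)`, relative to the fixed density `μ₀`. -/
def kernelH (μ₀ σ b : ℝ → ℝ) (x z : ℝ) : ℝ :=
  (∫ y in (0 : ℝ)..1,
    ((Icc z x).indicator (fun _ => (1 : ℝ)) y
        - (Icc z 1).indicator (fun _ => (1 : ℝ)) y * ∫ u in y..1, μ₀ u)
      * Real.exp (-driftExponent σ b y))
    * (invDensity σ b z / μ₀ z)

/-- The Green kernel `K_{σb}(x, z)`, relative to the fixed density `μ₀`: the kernel with respect to
`μ₀(z) dz` of the inverse of `L_{σb} - μ₀(L_{σb})` on the `μ₀`-centred functions. -/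
def greenKernel (μ₀ σ b : ℝ → ℝ) (x z : ℝ) : ℝ :=
  2 * normConst σ b *
    (kernelH μ₀ σ b x z
      - invDensity σ b z / μ₀ z * ∫ y in (0 : ℝ)..1, kernelH μ₀ σ b x y * μ₀ y)

/-- The `L¹` modulus of smoothness of order `r` on `[0,1]`:
`ω_r(g, t) = sup_{0 < h ≤ t} ‖Δ_h^r g‖_{L¹([0, 1 - r h])}`. -/
def modulusL1 (r : ℕ) (g : ℝ → ℝ) (t : ℝ) : ℝ≥0∞ :=
  ⨆ h ∈ Ioc (0 : ℝ) t,
    eLpNorm ((fwdDiff h)^[r] g) 1 (volume.restrict (Icc (0 : ℝ) (1 - r * h)))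

/-- The norm of the Besov space `B^s_{1∞}([0,1])`, `s > 0`:
`‖g‖_{L¹} + sup_{t > 0} t^{-s} ω_r(g, t)` with `r` the least integer larger than `s`. -/
def besovNorm (s : ℝ) (g : ℝ → ℝ) : ℝ≥0∞ :=
  eLpNorm g 1 (volume.restrict (Icc (0 : ℝ) 1))
    + ⨆ t ∈ Ioi (0 : ℝ), modulusL1 (⌊s⌋₊ + 1) g t / ENNReal.ofReal (t ^ s)

/-- The dual norm `‖f‖_{(B^s_{1∞})^*}`, the supremum of `|∫₀¹ f g|` over the unit ball of
`B^s_{1∞}([0,1])`, for `f` bounded and measurable on `[0,1]`. -/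
def besovDualNorm (s : ℝ) (f : ℝ → ℝ) : ℝ≥0∞ :=
  ⨆ g ∈ {g : ℝ → ℝ | MemLp g 1 (volume.restrict (Icc (0 : ℝ) 1)) ∧ besovNorm s g ≤ 1},
    ENNReal.ofReal |∫ x in (0 : ℝ)..1, f x * g x|

end ReflectedDiffusion

end

/-!
Write `s = 1/σ²` and `μ` for the invariant density. Since `μ σ² = exp (∫₀ 2b/σ²) / G`, the scale
density satisfies `2 G exp (-∫₀ 2b/σ²) = 2 s / μ` (`two_mul_normConst_mul_exp`). The Green kernel is
therefore a function of `μ`, `s` and `μ₀` alone: it equals `(μ z / μ₀ z) (k(x, z) - ∫ μ k(x, ·))`,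
where `k(x, z) = ∫ (1_{[z,x]} - 1_{[z,1]} ∫_y^1 μ₀) 2 s / μ dy` (`greenKernel_eq`). The drift has been
eliminated, so the estimate holds without the term in `b - b₀`, which is nonnegative.

To compare two kernels, split
`2 s / μ - 2 s₀ / μ₀ = 2 s (1/μ - 1/μ₀) + (s - s₀) · 2 / μ₀`.
As the densities are bounded away from `0` and `∞` uniformly on `Θ(D, d)`, the first summand is at
most a constant times `|μ - μ₀|`. The second is integrated against a product of an indicator of an
interval with a Lipschitz function. Such a product has bounded variation, hence lies in `B¹_{1∞}`
with a norm independent of the interval (`besovNorm_one_indicator_le`), and the integral is at most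
a constant times the dual norm of `s - s₀`. This gives a bound on the difference of the kernels that
is uniform in `x` and depends on `z` only through `|μ z - μ₀ z|` (`abs_kernel_sub_le`); its square
is then integrated.
-/

namespace ReflectedDiffusion

/-! ### The Besov norm and its dual -/

lemma besovNorm_const_smul (s c : ℝ) (g : ℝ → ℝ) :
    besovNorm s (c • g) = ‖c‖ₑ * besovNorm s g := by
  simp only [besovNorm, modulusL1, fwdDiff_iter_const_smul, eLpNorm_const_smul, mul_add,
    ENNReal.mul_iSup, div_eq_mul_inv, ENNReal.iSup_mul, mul_assoc]

/-- Duality in homogeneous form: the pairing with a function of Besov norm at most `R` is at most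
`R` times the dual norm. -/
lemma abs_integral_mul_le_besovDualNorm {s R : ℝ} {f g : ℝ → ℝ} (hR : 0 < R)
    (hg : MemLp g 1 (volume.restrict (Icc (0 : ℝ) 1)))
    (hgR : besovNorm s g ≤ ENNReal.ofReal R) (hf : besovDualNorm s f ≠ ⊤) :
    |∫ x in (0 : ℝ)..1, f x * g x| ≤ R * (besovDualNorm s f).toReal := by
  have hmem : R⁻¹ • g ∈ {g : ℝ → ℝ | MemLp g 1 (volume.restrict (Icc (0 : ℝ) 1)) ∧
      besovNorm s g ≤ 1} := by
    refine ⟨hg.const_smul _, ?_⟩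
    rw [besovNorm_const_smul, Real.enorm_eq_ofReal (inv_nonneg.2 hR.le)]
    calc ENNReal.ofReal R⁻¹ * besovNorm s g ≤ ENNReal.ofReal R⁻¹ * ENNReal.ofReal R := by gcongr
      _ = 1 := by
        rw [← ENNReal.ofReal_mul (inv_nonneg.2 hR.le), inv_mul_cancel₀ hR.ne', ENNReal.ofReal_one]
  have h1 : ENNReal.ofReal |∫ x in (0 : ℝ)..1, f x * (R⁻¹ • g) x| ≤ besovDualNorm s f :=
    le_iSup₂_of_le (R⁻¹ • g) hmem le_rfl
  have h2 := (ENNReal.ofReal_le_iff_le_toReal hf).1 h1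
  have h3 : ∫ x in (0 : ℝ)..1, f x * (R⁻¹ • g) x = R⁻¹ * ∫ x in (0 : ℝ)..1, f x * g x := by
    rw [← intervalIntegral.integral_const_mul]
    refine intervalIntegral.integral_congr fun x _ => ?_
    simp only [Pi.smul_apply, smul_eq_mul]
    ring
  rw [h3, abs_mul, abs_of_pos (inv_pos.2 hR), inv_mul_le_iff₀ hR] at h2
  exact h2

/-- The first difference of a truncated Lipschitz function is of order `h`, except within distance
`h` of the two jumps. -/
lemma enorm_fwdDiff_indicator_le {A B h z x u : ℝ} {f : ℝ → ℝ}
    (hB : ∀ y ∈ Icc (0 : ℝ) 1, |f y| ≤ B)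
    (hA : ∀ y ∈ Icc (0 : ℝ) 1, ∀ y' ∈ Icc (0 : ℝ) 1, |f y - f y'| ≤ A * |y - y'|)
    (hh : 0 < h) (hu : u ∈ Icc (0 : ℝ) 1) (huh : u + h ∈ Icc (0 : ℝ) 1) :
    ‖fwdDiff h ((Icc z x).indicator f) u‖ₑ ≤ ENNReal.ofReal (A * h) +
      ((Icc (z - h) z).indicator (fun _ => ENNReal.ofReal B) u
        + (Icc (x - h) x).indicator (fun _ => ENNReal.ofReal B) u) := by
  rw [Real.enorm_eq_ofReal_abs, fwdDiff]
  by_cases h1 : u ∈ Icc z x <;> by_cases h2 : u + h ∈ Icc z x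
  · rw [indicator_of_mem h1, indicator_of_mem h2]
    refine le_add_right (ENNReal.ofReal_le_ofReal ?_)
    simpa [abs_of_pos hh] using hA _ huh _ hu
  · have : u ∈ Icc (x - h) x := by
      simp only [mem_Icc, not_and, not_le] at *
      constructor <;> linarith [h2 (by linarith)]
    rw [indicator_of_mem h1, indicator_of_notMem h2, indicator_of_mem this, zero_sub, abs_neg]
    exact (ENNReal.ofReal_le_ofReal (hB u hu)).trans (le_add_left (le_add_left le_rfl))
  · have : u ∈ Icc (z - h) z := by
      simp only [mem_Icc, not_and, not_le] at *
      constructor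
      · linarith
      · by_contra! hc
        linarith [h1 hc.le]
    rw [indicator_of_notMem h1, indicator_of_mem h2, indicator_of_mem this, sub_zero]
    exact (ENNReal.ofReal_le_ofReal (hB _ huh)).trans (le_add_left (le_add_right le_rfl))
  · rw [indicator_of_notMem h1, indicator_of_notMem h2]
    simp

lemma setLIntegral_indicator_Icc_le (s : Set ℝ) (a h : ℝ) (c : ℝ≥0∞) :
    ∫⁻ u in s, (Icc (a - h) a).indicator (fun _ => c) u ≤ c * ENNReal.ofReal h := by
  refine (setLIntegral_le_lintegral _ _).trans ?_
  rw [lintegral_indicator_const measurableSet_Icc, Real.volume_Icc, sub_sub_cancel]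

lemma eLpNorm_fwdDiff_two_indicator_le {A B h z x : ℝ} {f : ℝ → ℝ}
    (hB : ∀ y ∈ Icc (0 : ℝ) 1, |f y| ≤ B)
    (hA : ∀ y ∈ Icc (0 : ℝ) 1, ∀ y' ∈ Icc (0 : ℝ) 1, |f y - f y'| ≤ A * |y - y'|)
    (hA0 : 0 ≤ A) (hB0 : 0 ≤ B) (hh : 0 < h) :
    eLpNorm ((fwdDiff h)^[2] ((Icc z x).indicator f)) 1
      (volume.restrict (Icc (0 : ℝ) (1 - 2 * h))) ≤ ENNReal.ofReal ((2 * A + 4 * B) * h) := by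
  set g := (Icc z x).indicator f
  set c := ENNReal.ofReal B
  set a := ENNReal.ofReal (A * h)
  have hmeas : ∀ a : ℝ, Measurable ((Icc (a - h) a).indicator fun _ : ℝ => c) := fun a =>
    measurable_const.indicator measurableSet_Icc
  rw [eLpNorm_one_eq_lintegral_enorm]
  have hpt : ∀ u ∈ Icc (0 : ℝ) (1 - 2 * h), ‖(fwdDiff h)^[2] g u‖ₑ ≤
      (a + a) + ((Icc (z - h) z).indicator (fun _ => c) u + (Icc (x - h) x).indicator (fun _ => c) u
      + ((Icc (z - h - h) (z - h)).indicator (fun _ => c) u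
        + (Icc (x - h - h) (x - h)).indicator (fun _ => c) u)) := by
    rintro u ⟨hu0, hu1⟩
    have e1 := enorm_fwdDiff_indicator_le (z := z) (x := x) (u := u) hB hA hh
      ⟨hu0, by linarith⟩ ⟨by linarith, by linarith⟩
    have e2 := enorm_fwdDiff_indicator_le (z := z) (x := x) (u := u + h) hB hA hh
      ⟨by linarith, by linarith⟩ ⟨by linarith, by linarith⟩
    have shift : ∀ w : ℝ, (Icc (w - h) w).indicator (fun _ => c) (u + h)
        = (Icc (w - h - h) (w - h)).indicator (fun _ => c) u := by
      intro w
      simp only [indicator, mem_Icc, sub_le_iff_le_add, le_sub_iff_add_le]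
    rw [shift, shift] at e2
    calc ‖(fwdDiff h)^[2] g u‖ₑ = ‖fwdDiff h g (u + h) - fwdDiff h g u‖ₑ := rfl
      _ ≤ ‖fwdDiff h g (u + h)‖ₑ + ‖fwdDiff h g u‖ₑ := enorm_sub_le
      _ ≤ _ := add_le_add e2 e1
      _ = _ := by ring
  have hmeas₂ : Measurable fun u =>
      (Icc (z - h) z).indicator (fun _ => c) u + (Icc (x - h) x).indicator (fun _ => c) u :=
    (hmeas z).add (hmeas x)
  -- For `h > 1/2` the domain is empty, so its measure is at most `1` for every `h > 0`.
  have hvol : ∫⁻ _ in Icc (0 : ℝ) (1 - 2 * h), (a + a) ≤ a + a := by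
    rw [setLIntegral_const, Real.volume_Icc]
    refine mul_le_of_le_one_right' ?_
    rw [← ENNReal.ofReal_one]
    exact ENNReal.ofReal_le_ofReal (by linarith)
  refine (setLIntegral_mono' measurableSet_Icc hpt).trans ?_
  rw [lintegral_add_left measurable_const, lintegral_add_left hmeas₂,
    lintegral_add_left (hmeas z), lintegral_add_left (hmeas (z - h))]
  refine (add_le_add hvol (add_le_add
    (add_le_add (setLIntegral_indicator_Icc_le _ _ _ _) (setLIntegral_indicator_Icc_le _ _ _ _))
    (add_le_add (setLIntegral_indicator_Icc_le _ _ _ _)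
      (setLIntegral_indicator_Icc_le _ _ _ _)))).trans (le_of_eq ?_)
  rw [← ENNReal.ofReal_mul hB0, ← ENNReal.ofReal_add (by positivity) (by positivity),
    ← ENNReal.ofReal_add (by positivity) (by positivity),
    ← ENNReal.ofReal_add (by positivity) (by positivity),
    ← ENNReal.ofReal_add (by positivity) (by positivity)]
  congr 1
  ring

/-- Truncations of Lipschitz functions to intervals have bounded variation, hence belong to
`B¹_{1∞}`, with a norm that does not depend on the interval. -/
lemma besovNorm_one_indicator_le {A B z x : ℝ} {f : ℝ → ℝ}
    (hB : ∀ y ∈ Icc (0 : ℝ) 1, |f y| ≤ B)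
    (hA : ∀ y ∈ Icc (0 : ℝ) 1, ∀ y' ∈ Icc (0 : ℝ) 1, |f y - f y'| ≤ A * |y - y'|)
    (hA0 : 0 ≤ A) (hB0 : 0 ≤ B) :
    besovNorm 1 ((Icc z x).indicator f) ≤ ENNReal.ofReal (2 * A + 5 * B) := by
  have h1 : eLpNorm ((Icc z x).indicator f) 1 (volume.restrict (Icc (0 : ℝ) 1))
      ≤ ENNReal.ofReal B := by
    rw [eLpNorm_one_eq_lintegral_enorm]
    calc ∫⁻ u in Icc (0 : ℝ) 1, ‖(Icc z x).indicator f u‖ₑ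
        ≤ ∫⁻ _ in Icc (0 : ℝ) 1, ENNReal.ofReal B := by
          refine setLIntegral_mono' measurableSet_Icc fun u hu => ?_
          refine (enorm_indicator_le_enorm_self _ _).trans ?_
          rw [Real.enorm_eq_ofReal_abs]
          exact ENNReal.ofReal_le_ofReal (hB u hu)
      _ = ENNReal.ofReal B := by simp
  have h2 : ⨆ t ∈ Ioi (0 : ℝ), modulusL1 (⌊(1 : ℝ)⌋₊ + 1) ((Icc z x).indicator f) t
      / ENNReal.ofReal (t ^ (1 : ℝ)) ≤ ENNReal.ofReal (2 * A + 4 * B) := by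
    refine iSup₂_le fun t ht => ?_
    rw [mem_Ioi] at ht
    rw [Real.rpow_one]
    refine ENNReal.div_le_of_le_mul ?_
    rw [← ENNReal.ofReal_mul (by positivity), Nat.floor_one]
    refine iSup₂_le fun h hh => ?_
    refine le_trans ?_ (ENNReal.ofReal_le_ofReal
      (mul_le_mul_of_nonneg_left hh.2 (by positivity : 0 ≤ 2 * A + 4 * B)))
    simpa using eLpNorm_fwdDiff_two_indicator_le (z := z) (x := x) hB hA hA0 hB0 hh.1
  refine (add_le_add h1 h2).trans (le_of_eq ?_)
  rw [← ENNReal.ofReal_add hB0 (by positivity)]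
  congr 1
  ring

/-- The pairing of `F` with a Lipschitz function over a subinterval is controlled by the norm of
`F` in the dual of `B¹_{1∞}`. -/
lemma abs_integral_mul_indicator_le {A B z x : ℝ} {F f : ℝ → ℝ}
    (hB : ∀ y ∈ Icc (0 : ℝ) 1, |f y| ≤ B)
    (hA : ∀ y ∈ Icc (0 : ℝ) 1, ∀ y' ∈ Icc (0 : ℝ) 1, |f y - f y'| ≤ A * |y - y'|)
    (hA0 : 0 ≤ A) (hB0 : 0 < B) (hf : ContinuousOn f (Icc 0 1)) (hF : besovDualNorm 1 F ≠ ⊤) :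
    |∫ y in (0 : ℝ)..1, F y * (Icc z x).indicator f y|
      ≤ (2 * A + 5 * B) * (besovDualNorm 1 F).toReal := by
  refine abs_integral_mul_le_besovDualNorm (by positivity) ?_
    (besovNorm_one_indicator_le hB hA hA0 hB0.le) hF
  exact (memLp_one_iff_integrable.2 hf.integrableOn_Icc).indicator measurableSet_Icc

/-! ### Bounds uniform over the parameter class -/

section UniformBounds

lemma abs_exp_sub_exp_le {a b k : ℝ} (ha : a ≤ k) (hb : b ≤ k) :
    |Real.exp a - Real.exp b| ≤ Real.exp k * |a - b| := by
  wlog hab : b ≤ a generalizing a b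
  · rw [abs_sub_comm, abs_sub_comm a]
    exact this hb ha (le_of_not_ge hab)
  rw [abs_of_nonneg (sub_nonneg.2 (Real.exp_le_exp.2 hab)), abs_of_nonneg (sub_nonneg.2 hab)]
  have h1 : Real.exp b = Real.exp a * Real.exp (b - a) := by rw [← Real.exp_add]; ring_nf
  have h2 := Real.add_one_le_exp (b - a)
  have h3 : Real.exp a ≤ Real.exp k := Real.exp_le_exp.2 ha
  have h4 := Real.exp_pos a
  nlinarith

lemma abs_mul_sub_mul_le {a b a' b' A B k l : ℝ} (ha : |a| ≤ A) (hb' : |b'| ≤ B)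
    (h1 : |a - a'| ≤ k) (h2 : |b - b'| ≤ l) (hA : 0 ≤ A) (hk : 0 ≤ k) :
    |a * b - a' * b'| ≤ A * l + k * B := by
  calc |a * b - a' * b'| = |a * (b - b') + (a - a') * b'| := by ring_nf
    _ ≤ |a| * |b - b'| + |a - a'| * |b'| := by
      rw [← abs_mul, ← abs_mul]
      exact abs_add_le _ _
    _ ≤ A * l + k * B := by gcongr

variable {D d : ℝ} {σ b : ℝ → ℝ}

lemma continuousOn_drift (h : (σ, b) ∈ Theta D d) : ContinuousOn b (Icc 0 1) :=
  h.1.continuousOn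

lemma continuousOn_diffusion (h : (σ, b) ∈ Theta D d) : ContinuousOn σ (Icc 0 1) :=
  h.2.1.continuousOn

lemma sq_diffusion_pos (hd : 0 < d) (h : (σ, b) ∈ Theta D d) {x : ℝ} (hx : x ∈ Icc (0 : ℝ) 1) :
    0 < σ x ^ 2 := hd.trans_le (h.2.2.2.2.2.2.2.2 x hx)

lemma sq_diffusion_le (h : (σ, b) ∈ Theta D d) {x : ℝ} (hx : x ∈ Icc (0 : ℝ) 1) :
    σ x ^ 2 ≤ D ^ 2 := by
  have := (h.2.2.2.2.2.2.2.1 x hx).2.2.1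
  exact sq_le_sq' (abs_le.1 this).1 (abs_le.1 this).2

lemma continuousOn_inv_sq_diffusion (hd : 0 < d) (h : (σ, b) ∈ Theta D d) :
    ContinuousOn (fun x => 1 / σ x ^ 2) (Icc 0 1) :=
  continuousOn_const.div ((continuousOn_diffusion h).pow 2) fun _ hx => (sq_diffusion_pos hd h hx).ne'

lemma abs_diffusion_sub_le (h : (σ, b) ∈ Theta D d) {x y : ℝ} (hx : x ∈ Icc (0 : ℝ) 1)
    (hy : y ∈ Icc (0 : ℝ) 1) : |σ x - σ y| ≤ D * |x - y| := by
  have := (convex_Icc (0 : ℝ) 1).norm_image_sub_le_of_norm_derivWithin_le (𝕜 := ℝ)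
    (f := σ) (C := D)
    h.2.1 (fun x hx => (h.2.2.2.2.2.2.2.1 x hx).2.2.2.1) hy hx
  simpa using this

lemma abs_driftExponent_sub_le (hD : 0 < D) (hd : 0 < d) (h : (σ, b) ∈ Theta D d) {x y : ℝ}
    (hx : x ∈ Icc (0 : ℝ) 1) (hy : y ∈ Icc (0 : ℝ) 1) :
    |driftExponent σ b x - driftExponent σ b y| ≤ 2 * D / d * |x - y| := by
  have hc : ContinuousOn (fun y => 2 * b y / σ y ^ 2) (Icc 0 1) :=
    (continuousOn_const.mul (continuousOn_drift h)).div ((continuousOn_diffusion h).pow 2)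
      fun _ hx => (sq_diffusion_pos hd h hx).ne'
  have h0 : (0 : ℝ) ∈ Icc (0 : ℝ) 1 := ⟨le_rfl, zero_le_one⟩
  have hi : ∀ z ∈ Icc (0 : ℝ) 1, IntervalIntegrable (fun y => 2 * b y / σ y ^ 2) volume 0 z :=
    fun z hz => (hc.mono (uIcc_subset_Icc h0 hz)).intervalIntegrable
  rw [driftExponent, driftExponent, intervalIntegral.integral_interval_sub_left (hi x hx) (hi y hy)]
  rw [← Real.norm_eq_abs]
  refine intervalIntegral.norm_integral_le_of_norm_le_const fun u hu => ?_
  have hu' : u ∈ Icc (0 : ℝ) 1 := uIcc_subset_Icc hy hx (uIoc_subset_uIcc hu)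
  rw [Real.norm_eq_abs, abs_div, abs_mul, abs_two, abs_of_pos (sq_diffusion_pos hd h hu')]
  have h1 := (h.2.2.2.2.2.2.2.1 u hu').1
  have h2 := h.2.2.2.2.2.2.2.2 u hu'
  gcongr

lemma abs_driftExponent_le (hD : 0 < D) (hd : 0 < d) (h : (σ, b) ∈ Theta D d) {x : ℝ}
    (hx : x ∈ Icc (0 : ℝ) 1) : |driftExponent σ b x| ≤ 2 * D / d := by
  have h1 := abs_driftExponent_sub_le hD hd h hx (y := 0) ⟨le_rfl, zero_le_one⟩
  have h2 : driftExponent σ b 0 = 0 := intervalIntegral.integral_same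
  rw [h2, sub_zero, sub_zero, abs_of_nonneg hx.1] at h1
  exact h1.trans (mul_le_of_le_one_right (by positivity) hx.2)

lemma continuousOn_driftExponent (hD : 0 < D) (hd : 0 < d) (h : (σ, b) ∈ Theta D d) :
    ContinuousOn (driftExponent σ b) (Icc 0 1) := by
  have : LipschitzOnWith (Real.toNNReal (2 * D / d)) (driftExponent σ b) (Icc 0 1) :=
    LipschitzOnWith.of_dist_le' fun x hx y hy => abs_driftExponent_sub_le hD hd h hx hy
  exact this.continuousOn

lemma normConst_bounds (hD : 0 < D) (hd : 0 < d) (h : (σ, b) ∈ Theta D d) :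
    1 / D ^ 2 * Real.exp (-(2 * D / d)) ≤ normConst σ b ∧
      normConst σ b ≤ 1 / d * Real.exp (2 * D / d) := by
  have hc : IntervalIntegrable (fun y => 1 / σ y ^ 2 * Real.exp (driftExponent σ b y)) volume
      0 1 := by
    apply ContinuousOn.intervalIntegrable
    rw [uIcc_of_le zero_le_one]
    exact (continuousOn_inv_sq_diffusion hd h).mul (continuousOn_driftExponent hD hd h).rexp
  have hpt : ∀ y ∈ Icc (0 : ℝ) 1, 1 / D ^ 2 * Real.exp (-(2 * D / d)) ≤
      1 / σ y ^ 2 * Real.exp (driftExponent σ b y) ∧ 1 / σ y ^ 2 * Real.exp (driftExponent σ b y)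
      ≤ 1 / d * Real.exp (2 * D / d) := by
    intro y hy
    have h1 := abs_le.1 (abs_driftExponent_le hD hd h hy)
    have h2 := sq_diffusion_pos hd h hy
    have h3 := sq_diffusion_le h hy
    have h4 := h.2.2.2.2.2.2.2.2 y hy
    have h5 := h1.1
    have h6 := h1.2
    constructor <;> gcongr
  constructor
  · have := intervalIntegral.integral_mono_on zero_le_one (intervalIntegrable_const
      (c := 1 / D ^ 2 * Real.exp (-(2 * D / d)))) hc fun y hy => (hpt y hy).1
    simpa [normConst] using this
  · have := intervalIntegral.integral_mono_on zero_le_one hc (intervalIntegrable_const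
      (c := 1 / d * Real.exp (2 * D / d))) fun y hy => (hpt y hy).2
    simpa [normConst] using this

lemma normConst_pos (hD : 0 < D) (hd : 0 < d) (h : (σ, b) ∈ Theta D d) : 0 < normConst σ b :=
  lt_of_lt_of_le (by positivity) (normConst_bounds hD hd h).1

lemma invDensity_pos (hD : 0 < D) (hd : 0 < d) (h : (σ, b) ∈ Theta D d) {x : ℝ}
    (hx : x ∈ Icc (0 : ℝ) 1) : 0 < invDensity σ b x := by
  have := normConst_pos hD hd h
  have := sq_diffusion_pos hd h hx
  rw [invDensity]
  positivity

lemma inv_invDensity (σ b : ℝ → ℝ) (x : ℝ) :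
    1 / invDensity σ b x = normConst σ b * (σ x ^ 2 * Real.exp (-driftExponent σ b x)) := by
  rw [invDensity, Real.exp_neg]
  simp only [one_div, mul_inv_rev, inv_inv]
  ring

lemma continuousOn_invDensity (hD : 0 < D) (hd : 0 < d) (h : (σ, b) ∈ Theta D d) :
    ContinuousOn (invDensity σ b) (Icc 0 1) := by
  have hG := normConst_pos hD hd h
  unfold invDensity
  refine (continuousOn_const.div (continuousOn_const.mul ((continuousOn_diffusion h).pow 2))
    fun x hx => ?_).mul (continuousOn_driftExponent hD hd h).rexp
  exact (mul_pos hG (sq_diffusion_pos hd h hx)).ne'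

/-- The scale density `exp (-∫₀ʸ 2b/σ²)` is expressed through the invariant density and `1/σ²`
alone; this is what eliminates the drift from the comparison of two kernels. -/
lemma two_mul_normConst_mul_exp (hd : 0 < d) (h : (σ, b) ∈ Theta D d) {x : ℝ}
    (hx : x ∈ Icc (0 : ℝ) 1) : 2 * normConst σ b * Real.exp (-driftExponent σ b x)
      = 2 * (1 / σ x ^ 2) * (1 / invDensity σ b x) := by
  rw [inv_invDensity]
  have : σ x ≠ 0 := pow_ne_zero_iff two_ne_zero |>.1 (sq_diffusion_pos hd h hx).ne'
  field_simp

/-- The quantitative information on an invariant density `μ` and an inverse squared diffusion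
coefficient `s = 1/σ²` that the comparison of Green kernels uses. -/
structure UniformlyBounded (Λ : ℝ) (μ s : ℝ → ℝ) : Prop where
  continuousOn_density : ContinuousOn μ (Icc 0 1)
  continuousOn_inv_sq : ContinuousOn s (Icc 0 1)
  density_pos : ∀ x ∈ Icc (0 : ℝ) 1, 0 < μ x
  density_le : ∀ x ∈ Icc (0 : ℝ) 1, μ x ≤ Λ
  inv_density_le : ∀ x ∈ Icc (0 : ℝ) 1, 1 / μ x ≤ Λ
  inv_sq_pos : ∀ x ∈ Icc (0 : ℝ) 1, 0 < s x
  inv_sq_le : ∀ x ∈ Icc (0 : ℝ) 1, s x ≤ Λ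
  inv_density_lipschitz : ∀ x ∈ Icc (0 : ℝ) 1, ∀ y ∈ Icc (0 : ℝ) 1,
    |1 / μ x - 1 / μ y| ≤ Λ * |x - y|

lemma exists_uniformlyBounded (hD : 0 < D) (hd : 0 < d) :
    ∃ Λ : ℝ, 1 ≤ Λ ∧ ∀ σ b : ℝ → ℝ, (σ, b) ∈ Theta D d →
      UniformlyBounded Λ (invDensity σ b) (fun x => 1 / σ x ^ 2) := by
  suffices H : ∃ Λ : ℝ, 1 ≤ Λ ∧ ∀ σ b : ℝ → ℝ, (σ, b) ∈ Theta D d →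
      (∀ x ∈ Icc (0 : ℝ) 1, 1 / σ x ^ 2 ≤ Λ ∧ invDensity σ b x ≤ Λ ∧ 1 / invDensity σ b x ≤ Λ) ∧
      ∀ x ∈ Icc (0 : ℝ) 1, ∀ y ∈ Icc (0 : ℝ) 1,
        |1 / invDensity σ b x - 1 / invDensity σ b y| ≤ Λ * |x - y| by
    obtain ⟨Λ, hΛ, H⟩ := H
    refine ⟨Λ, hΛ, fun σ b h => ⟨continuousOn_invDensity hD hd h,
      continuousOn_inv_sq_diffusion hd h, fun x hx => invDensity_pos hD hd h hx,
      fun x hx => ((H σ b h).1 x hx).2.1, fun x hx => ((H σ b h).1 x hx).2.2,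
      fun x hx => one_div_pos.2 (sq_diffusion_pos hd h hx),
      fun x hx => ((H σ b h).1 x hx).1, (H σ b h).2⟩⟩
  set k := 2 * D / d with hk
  have hk0 : 0 < k := by positivity
  set E := Real.exp k with hE
  have hE0 : 0 < E := Real.exp_pos k
  set Γ := 1 / d * E with hΓ
  have hΓ0 : 0 < Γ := by positivity
  set U := 1 / (1 / D ^ 2 * Real.exp (-k) * d) * E with hU
  have hU0 : 0 < U := by positivity
  set L := D ^ 2 * (E * k) + (D * D + D * D) * E with hL
  have hL0 : 0 < L := by positivity
  -- The summands bound, in this order, `1/σ²`, `μ`, `1/μ` and the Lipschitz constant of `1/μ`;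
  -- the leading `1` secures `1 ≤ Λ`.
  refine ⟨1 + 1 / d + U + Γ * (D ^ 2 * E) + Γ * L, ?_, fun σ b h => ⟨fun x hx => ?_,
    fun x hx y hy => ?_⟩⟩
  · have : 0 < 1 / d := by positivity
    nlinarith [mul_pos hΓ0 hL0, mul_pos hΓ0 (mul_pos (pow_pos hD 2) hE0)]
  · have h1 := abs_le.1 (abs_driftExponent_le hD hd h hx)
    have h1l := h1.1
    have h1r := h1.2
    have h2 := sq_diffusion_pos hd h hx
    have h3 := sq_diffusion_le h hx
    have h4 := h.2.2.2.2.2.2.2.2 x hx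
    have hG0 := normConst_pos hD hd h
    obtain ⟨hGl, hGr⟩ := normConst_bounds hD hd h
    have hd0 : 0 < 1 / d := by positivity
    have t1 := mul_pos hΓ0 hL0
    have t2 := mul_pos hΓ0 (mul_pos (pow_pos hD 2) hE0)
    have b1 : 1 / σ x ^ 2 ≤ 1 / d := by gcongr
    have b2 : invDensity σ b x ≤ U := by
      have hIE : Real.exp (driftExponent σ b x) ≤ E := Real.exp_le_exp.2 h1r
      rw [invDensity, hU]
      gcongr
    have b3 : 1 / invDensity σ b x ≤ Γ * (D ^ 2 * E) := by
      rw [inv_invDensity]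
      have : Real.exp (-driftExponent σ b x) ≤ E := Real.exp_le_exp.2 (by linarith)
      gcongr
    refine ⟨?_, ?_, ?_⟩ <;> linarith
  · have hG0 := normConst_pos hD hd h
    have hGr := (normConst_bounds hD hd h).2
    have h3 := sq_diffusion_le h hx
    have hIx := abs_le.1 (abs_driftExponent_le hD hd h hx)
    have hIy := abs_le.1 (abs_driftExponent_le hD hd h hy)
    have hexp : |Real.exp (-driftExponent σ b x) - Real.exp (-driftExponent σ b y)|
        ≤ E * (k * |x - y|) := by
      refine (abs_exp_sub_exp_le (k := k) (by linarith) (by linarith)).trans ?_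
      refine mul_le_mul_of_nonneg_left ?_ hE0.le
      rw [neg_sub_neg, abs_sub_comm]
      exact abs_driftExponent_sub_le hD hd h hx hy
    have hsx := (h.2.2.2.2.2.2.2.1 x hx).2.2.1
    have hsy := (h.2.2.2.2.2.2.2.1 y hy).2.2.1
    have hsq : |σ x ^ 2 - σ y ^ 2| ≤ D * (D * |x - y|) + D * |x - y| * D := by
      rw [pow_two, pow_two]
      exact abs_mul_sub_mul_le hsx hsy (abs_diffusion_sub_le h hx hy)
        (abs_diffusion_sub_le h hx hy) hD.le (by positivity)
    have hprod : |σ x ^ 2 * Real.exp (-driftExponent σ b x)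
        - σ y ^ 2 * Real.exp (-driftExponent σ b y)| ≤ L * |x - y| := by
      refine (abs_mul_sub_mul_le (A := D ^ 2) (B := E) ?_ ?_ hsq hexp (by positivity)
        (by positivity)).trans (le_of_eq ?_)
      · rwa [abs_of_nonneg (sq_nonneg _)]
      · rw [Real.abs_exp]
        exact Real.exp_le_exp.2 (by linarith)
      · rw [hL]; ring
    have hd0 : 0 < 1 / d := by positivity
    have t2 := mul_pos hΓ0 (mul_pos (pow_pos hD 2) hE0)
    calc |1 / invDensity σ b x - 1 / invDensity σ b y|
        = normConst σ b * |σ x ^ 2 * Real.exp (-driftExponent σ b x)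
          - σ y ^ 2 * Real.exp (-driftExponent σ b y)| := by
          rw [inv_invDensity, inv_invDensity, ← mul_sub, abs_mul, abs_of_pos hG0]
      _ ≤ Γ * (L * |x - y|) := by gcongr
      _ = Γ * L * |x - y| := by ring
      _ ≤ _ := by
        refine mul_le_mul_of_nonneg_right ?_ (abs_nonneg _)
        linarith

end UniformBounds

/-! ### The Green kernel in terms of the invariant density and the diffusion coefficient -/

/-- The weight `1_{[z,x]}(y) - 1_{[z,1]}(y) ∫_y^1 μ₀` against which the scale density is integrated
in the Green kernel. -/
noncomputable def kernelWeight (μ₀ : ℝ → ℝ) (x z y : ℝ) : ℝ :=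
  (Icc z x).indicator (fun _ => (1 : ℝ)) y
    - (Icc z 1).indicator (fun _ => (1 : ℝ)) y * ∫ u in y..1, μ₀ u

/-- The integral of `p` against the kernel weight. -/
noncomputable def weightedPrimitive (μ₀ p : ℝ → ℝ) (x z : ℝ) : ℝ :=
  ∫ y in (0 : ℝ)..1, kernelWeight μ₀ x z y * p y

/-- The scale density `2 s / μ`, where `s = 1/σ²`. -/
noncomputable def scaleDensity (μ s : ℝ → ℝ) (y : ℝ) : ℝ := 2 * s y * (1 / μ y)

/-- The Green kernel as a function of `μ`, `s = 1/σ²` and `μ₀` only, without the factor `μ z / μ₀ z`. -/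
noncomputable def centredPrimitive (μ₀ μ s : ℝ → ℝ) (x z : ℝ) : ℝ :=
  weightedPrimitive μ₀ (scaleDensity μ s) x z
    - ∫ y in (0 : ℝ)..1, μ y * weightedPrimitive μ₀ (scaleDensity μ s) x y

lemma two_mul_normConst_mul_kernelH {D d : ℝ} {σ b : ℝ → ℝ} (hd : 0 < d)
    (h : (σ, b) ∈ Theta D d) (μ₀ : ℝ → ℝ) (x z : ℝ) :
    2 * normConst σ b * kernelH μ₀ σ b x z = invDensity σ b z / μ₀ z *
      weightedPrimitive μ₀ (scaleDensity (invDensity σ b) (fun y => 1 / σ y ^ 2)) x z := by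
  have : weightedPrimitive μ₀ (scaleDensity (invDensity σ b) (fun y => 1 / σ y ^ 2)) x z
      = 2 * normConst σ b * ∫ y in (0 : ℝ)..1,
        kernelWeight μ₀ x z y * Real.exp (-driftExponent σ b y) := by
    rw [weightedPrimitive, ← intervalIntegral.integral_const_mul]
    refine intervalIntegral.integral_congr fun y hy => ?_
    rw [uIcc_of_le zero_le_one] at hy
    simp only [scaleDensity]
    rw [← two_mul_normConst_mul_exp hd h hy]
    ring
  rw [this]
  simp only [kernelH, kernelWeight]
  ring

lemma greenKernel_eq {D d : ℝ} {σ b μ₀ : ℝ → ℝ} (hd : 0 < d)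
    (h : (σ, b) ∈ Theta D d) (hμ₀ : ∀ y ∈ Icc (0 : ℝ) 1, μ₀ y ≠ 0) (x z : ℝ) :
    greenKernel μ₀ σ b x z = invDensity σ b z / μ₀ z *
      centredPrimitive μ₀ (invDensity σ b) (fun y => 1 / σ y ^ 2) x z := by
  have : 2 * normConst σ b * ∫ y in (0 : ℝ)..1, kernelH μ₀ σ b x y * μ₀ y
      = ∫ y in (0 : ℝ)..1, invDensity σ b y * weightedPrimitive μ₀
        (scaleDensity (invDensity σ b) (fun y => 1 / σ y ^ 2)) x y := by
    rw [← intervalIntegral.integral_const_mul]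
    refine intervalIntegral.integral_congr fun y hy => ?_
    rw [uIcc_of_le zero_le_one] at hy
    have h0 := hμ₀ y hy
    change 2 * normConst σ b * (kernelH μ₀ σ b x y * μ₀ y) = _
    rw [← mul_assoc, two_mul_normConst_mul_kernelH hd h]
    field_simp
  rw [greenKernel, mul_sub, two_mul_normConst_mul_kernelH hd h, centredPrimitive, ← this]
  ring

/-! ### Weighted primitives -/

lemma intervalIntegrable_of_continuousOn_unit {f : ℝ → ℝ} (hf : ContinuousOn f (Icc 0 1)) :
    IntervalIntegrable f volume 0 1 := by
  rw [← uIcc_of_le zero_le_one] at hf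
  exact hf.intervalIntegrable

lemma intervalIntegrable_indicator {f : ℝ → ℝ} (hf : ContinuousOn f (Icc 0 1)) (z x : ℝ) :
    IntervalIntegrable ((Icc z x).indicator f) volume 0 1 := by
  rw [intervalIntegrable_iff_integrableOn_Icc_of_le zero_le_one]
  exact hf.integrableOn_Icc.indicator measurableSet_Icc

lemma abs_integral_unit_le {f : ℝ → ℝ} {c : ℝ} (hf : ∀ y ∈ Icc (0 : ℝ) 1, |f y| ≤ c) :
    |∫ y in (0 : ℝ)..1, f y| ≤ c := by
  have := intervalIntegral.norm_integral_le_of_norm_le_const (a := 0) (b := 1) (f := f) (C := c)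
    fun y hy => hf y (by rw [uIoc_of_le zero_le_one] at hy; exact Ioc_subset_Icc_self hy)
  simpa using this

lemma continuousOn_tail {f : ℝ → ℝ} (hf : ContinuousOn f (Icc 0 1)) :
    ContinuousOn (fun y => ∫ u in y..1, f u) (Icc 0 1) := by
  have := intervalIntegral.continuousOn_primitive_interval_left (f := f) (μ := volume) (a := 0)
    (b := 1) (by rw [uIcc_of_le zero_le_one]; exact hf.integrableOn_Icc)
  rwa [uIcc_of_le zero_le_one] at this

lemma abs_tail_sub_le {f : ℝ → ℝ} {c : ℝ} (hf : ContinuousOn f (Icc 0 1))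
    (hc : ∀ y ∈ Icc (0 : ℝ) 1, |f y| ≤ c) {x y : ℝ} (hx : x ∈ Icc (0 : ℝ) 1)
    (hy : y ∈ Icc (0 : ℝ) 1) :
    |(∫ u in x..1, f u) - ∫ u in y..1, f u| ≤ c * |x - y| := by
  have h1 : (1 : ℝ) ∈ Icc (0 : ℝ) 1 := ⟨zero_le_one, le_rfl⟩
  rw [intervalIntegral.integral_interval_sub_interval_comm
    (hf.mono (uIcc_subset_Icc hx h1)).intervalIntegrable
    (hf.mono (uIcc_subset_Icc hy h1)).intervalIntegrable
    (hf.mono (uIcc_subset_Icc hx hy)).intervalIntegrable, intervalIntegral.integral_same, sub_zero,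
    abs_sub_comm x y, ← Real.norm_eq_abs]
  exact intervalIntegral.norm_integral_le_of_norm_le_const fun u hu =>
    hc u (uIcc_subset_Icc hx hy (uIoc_subset_uIcc hu))

lemma abs_tail_le {f : ℝ → ℝ} {c : ℝ} (hc : ∀ y ∈ Icc (0 : ℝ) 1, |f y| ≤ c) {x : ℝ}
    (hx : x ∈ Icc (0 : ℝ) 1) : |∫ u in x..1, f u| ≤ c := by
  have h1 : (1 : ℝ) ∈ Icc (0 : ℝ) 1 := ⟨zero_le_one, le_rfl⟩
  have hc0 : 0 ≤ c := (abs_nonneg _).trans (hc x hx)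
  have := intervalIntegral.norm_integral_le_of_norm_le_const (a := x) (b := 1) (f := f) (C := c)
    fun u hu => hc u (uIcc_subset_Icc hx h1 (uIoc_subset_uIcc hu))
  refine this.trans (mul_le_of_le_one_right hc0 ?_)
  rw [abs_of_nonneg (by linarith [hx.2])]
  linarith [hx.1]

lemma integral_indicator_Icc {f : ℝ → ℝ} {z x : ℝ} (hz : z ∈ Icc (0 : ℝ) 1)
    (hx : x ∈ Icc (0 : ℝ) 1) :
    ∫ y in (0 : ℝ)..1, (Icc z x).indicator f y = ∫ y in (min z x)..x, f y := by
  rw [intervalIntegral.integral_of_le zero_le_one, ← integral_Icc_eq_integral_Ioc,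
    setIntegral_indicator measurableSet_Icc, inter_eq_right.2 (Icc_subset_Icc hz.1 hx.2)]
  rcases le_total z x with h | h
  · rw [min_eq_left h, intervalIntegral.integral_of_le h, integral_Icc_eq_integral_Ioc]
  · rw [min_eq_right h, intervalIntegral.integral_same, integral_Icc_eq_integral_Ioc, Ioc_eq_empty
      h.not_gt, setIntegral_empty]

lemma kernelWeight_mul (μ₀ p : ℝ → ℝ) (x z y : ℝ) :
    kernelWeight μ₀ x z y * p y = (Icc z x).indicator p y
      - (Icc z 1).indicator (fun y => (∫ u in y..1, μ₀ u) * p y) y := by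
  simp only [kernelWeight, indicator]
  split_ifs <;> ring

lemma intervalIntegrable_kernelWeight_mul {μ₀ p : ℝ → ℝ} (hμ₀ : ContinuousOn μ₀ (Icc 0 1))
    (hp : ContinuousOn p (Icc 0 1)) (x z : ℝ) :
    IntervalIntegrable (fun y => kernelWeight μ₀ x z y * p y) volume 0 1 := by
  simp only [kernelWeight_mul]
  exact (intervalIntegrable_indicator hp z x).sub
    (intervalIntegrable_indicator ((continuousOn_tail hμ₀).mul hp) z 1)

lemma weightedPrimitive_eq_sub {μ₀ p : ℝ → ℝ} (hμ₀ : ContinuousOn μ₀ (Icc 0 1))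
    (hp : ContinuousOn p (Icc 0 1)) (x z : ℝ) :
    weightedPrimitive μ₀ p x z = (∫ y in (0 : ℝ)..1, (Icc z x).indicator p y)
      - ∫ y in (0 : ℝ)..1, (Icc z 1).indicator (fun y => (∫ u in y..1, μ₀ u) * p y) y := by
  simp only [weightedPrimitive, kernelWeight_mul]
  exact intervalIntegral.integral_sub (intervalIntegrable_indicator hp z x)
    (intervalIntegrable_indicator ((continuousOn_tail hμ₀).mul hp) z 1)

lemma continuousOn_weightedPrimitive {μ₀ p : ℝ → ℝ} (hμ₀ : ContinuousOn μ₀ (Icc 0 1))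
    (hp : ContinuousOn p (Icc 0 1)) {x : ℝ} (hx : x ∈ Icc (0 : ℝ) 1) :
    ContinuousOn (weightedPrimitive μ₀ p x) (Icc 0 1) := by
  have h1 : (1 : ℝ) ∈ Icc (0 : ℝ) 1 := ⟨zero_le_one, le_rfl⟩
  have hq : ContinuousOn (fun y => (∫ u in y..1, μ₀ u) * p y) (Icc 0 1) :=
    (continuousOn_tail hμ₀).mul hp
  have hP : ContinuousOn (fun z => (∫ y in z..1, p y) - ∫ y in x..1, p y) (Icc 0 1) :=
    (continuousOn_tail hp).sub continuousOn_const
  have hPmin : ContinuousOn (fun z => (∫ y in (min z x)..1, p y) - ∫ y in x..1, p y) (Icc 0 1) :=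
    hP.comp (f := fun z => min z x) (continuous_id.min continuous_const).continuousOn
      fun z hz => ⟨le_min hz.1 hx.1, (min_le_left _ _).trans hz.2⟩
  refine (hPmin.sub (continuousOn_tail hq)).congr fun z hz => ?_
  have hm : min z x ∈ Icc (0 : ℝ) 1 := ⟨le_min hz.1 hx.1, (min_le_left _ _).trans hz.2⟩
  rw [weightedPrimitive_eq_sub hμ₀ hp, integral_indicator_Icc hz hx, integral_indicator_Icc hz h1,
    min_eq_left hz.2, Pi.sub_apply, ← intervalIntegral.integral_add_adjacent_intervals
      (a := min z x) (b := x) (c := 1) (hp.mono (uIcc_subset_Icc hm hx)).intervalIntegrable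
      (hp.mono (uIcc_subset_Icc hx h1)).intervalIntegrable, add_sub_cancel_right]

lemma abs_kernelWeight_le {μ₀ : ℝ → ℝ} {Λ : ℝ} (hΛ : ∀ y ∈ Icc (0 : ℝ) 1, |μ₀ y| ≤ Λ) (x z : ℝ)
    {y : ℝ} (hy : y ∈ Icc (0 : ℝ) 1) : |kernelWeight μ₀ x z y| ≤ 1 + Λ := by
  have h1 := abs_tail_le hΛ hy
  have h0 := (abs_nonneg _).trans h1
  refine (abs_sub _ _).trans (add_le_add ?_ ?_)
  · simp only [indicator]
    split_ifs <;> simp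
  · simp only [indicator]
    split_ifs
    · simpa using h1
    · simpa using h0

lemma abs_weightedPrimitive_le {μ₀ p : ℝ → ℝ} {Λ c : ℝ} (hΛ : ∀ y ∈ Icc (0 : ℝ) 1, |μ₀ y| ≤ Λ)
    (hc : ∀ y ∈ Icc (0 : ℝ) 1, |p y| ≤ c) (x z : ℝ) :
    |weightedPrimitive μ₀ p x z| ≤ (1 + Λ) * c := by
  refine abs_integral_unit_le fun y hy => ?_
  rw [abs_mul]
  have h1 := abs_kernelWeight_le hΛ x z hy
  exact mul_le_mul h1 (hc y hy) (abs_nonneg _) ((abs_nonneg _).trans h1)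

/-! ### Comparison of two Green kernels -/

section Comparison

variable {Λ : ℝ} {μ s μ₀ s₀ : ℝ → ℝ}

lemma UniformlyBounded.abs_density_le (h : UniformlyBounded Λ μ s) :
    ∀ y ∈ Icc (0 : ℝ) 1, |μ y| ≤ Λ := fun y hy => by
  rw [abs_of_pos (h.density_pos y hy)]
  exact h.density_le y hy

lemma UniformlyBounded.abs_inv_density_le (h : UniformlyBounded Λ μ s) :
    ∀ y ∈ Icc (0 : ℝ) 1, |1 / μ y| ≤ Λ := fun y hy => by
  rw [abs_of_pos (one_div_pos.2 (h.density_pos y hy))]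
  exact h.inv_density_le y hy

lemma UniformlyBounded.continuousOn_inv_density (h : UniformlyBounded Λ μ s) :
    ContinuousOn (fun y => 1 / μ y) (Icc 0 1) :=
  continuousOn_const.div h.continuousOn_density fun y hy => (h.density_pos y hy).ne'

lemma UniformlyBounded.continuousOn_scaleDensity (h : UniformlyBounded Λ μ s) :
    ContinuousOn (scaleDensity μ s) (Icc 0 1) :=
  (continuousOn_const.mul h.continuousOn_inv_sq).mul h.continuousOn_inv_density

lemma UniformlyBounded.abs_scaleDensity_le (h : UniformlyBounded Λ μ s) (hΛ : 1 ≤ Λ) :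
    ∀ y ∈ Icc (0 : ℝ) 1, |scaleDensity μ s y| ≤ 2 * Λ * Λ := fun y hy => by
  have h1 := h.abs_inv_density_le y hy
  have h2 := h.inv_sq_le y hy
  rw [scaleDensity, abs_mul, abs_mul, abs_two, abs_of_pos (h.inv_sq_pos y hy)]
  gcongr

lemma abs_inv_density_sub_le (h : UniformlyBounded Λ μ s) (h₀ : UniformlyBounded Λ μ₀ s₀)
    (hΛ : 1 ≤ Λ) {y : ℝ} (hy : y ∈ Icc (0 : ℝ) 1) :
    |1 / μ y - 1 / μ₀ y| ≤ Λ * Λ * |μ y - μ₀ y| := by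
  have e : 1 / μ y - 1 / μ₀ y = 1 / μ y * (1 / μ₀ y) * (μ₀ y - μ y) := by
    have := (h.density_pos y hy).ne'
    have := (h₀.density_pos y hy).ne'
    field_simp
  rw [e, abs_mul, abs_mul, abs_sub_comm (μ₀ y)]
  have h1 := h.abs_inv_density_le y hy
  have h2 := h₀.abs_inv_density_le y hy
  gcongr

lemma integral_abs_sub_nonneg (μ μ₀ : ℝ → ℝ) : 0 ≤ ∫ y in (0 : ℝ)..1, |μ y - μ₀ y| :=
  intervalIntegral.integral_nonneg zero_le_one fun _ _ => abs_nonneg _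

lemma intervalIntegrable_abs_density_sub (h : UniformlyBounded Λ μ s)
    (h₀ : UniformlyBounded Λ μ₀ s₀) :
    IntervalIntegrable (fun y => |μ y - μ₀ y|) volume 0 1 :=
  intervalIntegrable_of_continuousOn_unit (h.continuousOn_density.sub h₀.continuousOn_density).abs

/-- The pairing of the kernel weight with `2 (s - s₀) / μ₀` consists of two truncated Lipschitz test
functions, so that it is bounded by the dual norm of `s - s₀`. -/
lemma abs_weightedPrimitive_dual_le (h : UniformlyBounded Λ μ s)
    (h₀ : UniformlyBounded Λ μ₀ s₀) (hΛ : 1 ≤ Λ)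
    (hF : besovDualNorm 1 (fun y => s y - s₀ y) ≠ ⊤) (x z : ℝ) :
    |weightedPrimitive μ₀ (fun y => (s y - s₀ y) * (2 * (1 / μ₀ y))) x z|
      ≤ 32 * Λ ^ 2 * (besovDualNorm 1 (fun y => s y - s₀ y)).toReal := by
  set F := fun y => s y - s₀ y
  set g := fun y => 2 * (1 / μ₀ y) with hg
  set M := fun y => ∫ u in y..1, μ₀ u
  have hgc : ContinuousOn g (Icc 0 1) := continuousOn_const.mul h₀.continuousOn_inv_density
  have hMc : ContinuousOn M (Icc 0 1) := continuousOn_tail h₀.continuousOn_density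
  have hFc : ContinuousOn F (Icc 0 1) := h.continuousOn_inv_sq.sub h₀.continuousOn_inv_sq
  have hgB : ∀ y ∈ Icc (0 : ℝ) 1, |g y| ≤ 2 * Λ := fun y hy => by
    rw [hg, abs_mul, abs_two]
    have := h₀.abs_inv_density_le y hy
    gcongr
  have hgA : ∀ y ∈ Icc (0 : ℝ) 1, ∀ y' ∈ Icc (0 : ℝ) 1, |g y - g y'| ≤ 2 * Λ * |y - y'| :=
    fun y hy y' hy' => by
      simp only [hg]
      rw [← mul_sub, abs_mul, abs_two, mul_assoc]
      have := h₀.inv_density_lipschitz y hy y' hy'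
      gcongr
  have hMB : ∀ y ∈ Icc (0 : ℝ) 1, |M y| ≤ Λ := fun y hy => abs_tail_le h₀.abs_density_le hy
  have hMgB : ∀ y ∈ Icc (0 : ℝ) 1, |M y * g y| ≤ Λ * (2 * Λ) := fun y hy => by
    rw [abs_mul]
    exact mul_le_mul (hMB y hy) (hgB y hy) (abs_nonneg _) (by positivity)
  have hMgA : ∀ y ∈ Icc (0 : ℝ) 1, ∀ y' ∈ Icc (0 : ℝ) 1,
      |M y * g y - M y' * g y'| ≤ 4 * Λ * Λ * |y - y'| := fun y hy y' hy' => by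
    refine (abs_mul_sub_mul_le (hMB y hy) (hgB y' hy')
      (abs_tail_sub_le h₀.continuousOn_density h₀.abs_density_le hy hy') (hgA y hy y' hy')
      (by positivity) (by positivity)).trans (le_of_eq (by ring))
  have e1 : ∀ y, (Icc z x).indicator (fun y => F y * g y) y = F y * (Icc z x).indicator g y :=
    fun y => by simp only [indicator]; split_ifs <;> simp
  have e2 : ∀ y, (Icc z 1).indicator (fun y => M y * (F y * g y)) y
      = F y * (Icc z 1).indicator (fun y => M y * g y) y :=
    fun y => by simp only [indicator]; split_ifs <;> ring
  have hFg : ContinuousOn (fun y => F y * g y) (Icc 0 1) := hFc.mul hgc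
  change |weightedPrimitive μ₀ (fun y => F y * g y) x z| ≤ _
  rw [weightedPrimitive_eq_sub h₀.continuousOn_density hFg]
  simp only [e1]
  rw [intervalIntegral.integral_congr (g := fun y => F y * (Icc z 1).indicator
    (fun y => M y * g y) y) fun y _ => e2 y]
  have b1 := abs_integral_mul_indicator_le (z := z) (x := x) hgB hgA (by positivity)
    (by positivity) hgc hF
  have b2 := abs_integral_mul_indicator_le (z := z) (x := 1) hMgB hMgA (by positivity)
    (by positivity) (hMc.mul hgc) hF
  have hN : 0 ≤ (besovDualNorm 1 F).toReal := ENNReal.toReal_nonneg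
  refine (abs_sub _ _).trans ((add_le_add b1 b2).trans ?_)
  rw [← add_mul]
  refine mul_le_mul_of_nonneg_right ?_ hN
  nlinarith

/-- The scale densities differ by `2 s (1/μ - 1/μ₀)`, estimated in `L¹`, and `(s - s₀) · 2 / μ₀`,
estimated by duality. -/
lemma abs_weightedPrimitive_sub_le (h : UniformlyBounded Λ μ s)
    (h₀ : UniformlyBounded Λ μ₀ s₀) (hΛ : 1 ≤ Λ)
    (hF : besovDualNorm 1 (fun y => s y - s₀ y) ≠ ⊤) (x z : ℝ) :
    |weightedPrimitive μ₀ (scaleDensity μ s) x z - weightedPrimitive μ₀ (scaleDensity μ₀ s₀) x z|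
      ≤ 32 * Λ ^ 4 * ((∫ y in (0 : ℝ)..1, |μ y - μ₀ y|)
        + (besovDualNorm 1 (fun y => s y - s₀ y)).toReal) := by
  set q := fun y => 2 * s y * (1 / μ y - 1 / μ₀ y) with hq
  set r := fun y => (s y - s₀ y) * (2 * (1 / μ₀ y)) with hr
  have hqc : ContinuousOn q (Icc 0 1) := (continuousOn_const.mul h.continuousOn_inv_sq).mul
    (h.continuousOn_inv_density.sub h₀.continuousOn_inv_density)
  have hrc : ContinuousOn r (Icc 0 1) := (h.continuousOn_inv_sq.sub h₀.continuousOn_inv_sq).mul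
    (continuousOn_const.mul h₀.continuousOn_inv_density)
  have hμ₀c := h₀.continuousOn_density
  have split : weightedPrimitive μ₀ (scaleDensity μ s) x z
      - weightedPrimitive μ₀ (scaleDensity μ₀ s₀) x z
      = weightedPrimitive μ₀ q x z + weightedPrimitive μ₀ r x z := by
    simp only [weightedPrimitive]
    rw [← intervalIntegral.integral_sub
      (intervalIntegrable_kernelWeight_mul hμ₀c h.continuousOn_scaleDensity x z)
      (intervalIntegrable_kernelWeight_mul hμ₀c h₀.continuousOn_scaleDensity x z),
      ← intervalIntegral.integral_add (intervalIntegrable_kernelWeight_mul hμ₀c hqc x z)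
      (intervalIntegrable_kernelWeight_mul hμ₀c hrc x z)]
    refine intervalIntegral.integral_congr fun y _ => ?_
    simp only [scaleDensity, hq, hr]
    ring
  have hqb : |weightedPrimitive μ₀ q x z| ≤ (1 + Λ) * (2 * Λ * (Λ * Λ)) *
      ∫ y in (0 : ℝ)..1, |μ y - μ₀ y| := by
    refine (intervalIntegral.abs_integral_le_integral_abs zero_le_one).trans ?_
    rw [← intervalIntegral.integral_const_mul]
    refine intervalIntegral.integral_mono_on zero_le_one
      (intervalIntegrable_kernelWeight_mul hμ₀c hqc x z).abs
      ((intervalIntegrable_abs_density_sub h h₀).const_mul _) fun y hy => ?_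
    have h1 := abs_kernelWeight_le h₀.abs_density_le x z hy
    have h2 := abs_inv_density_sub_le h h₀ hΛ hy
    have h3 := h.inv_sq_le y hy
    have h4 := h.inv_sq_pos y hy
    rw [abs_mul, hq, abs_mul, abs_mul, abs_two, abs_of_pos h4]
    calc |kernelWeight μ₀ x z y| * (2 * s y * |1 / μ y - 1 / μ₀ y|)
        ≤ (1 + Λ) * (2 * Λ * (Λ * Λ * |μ y - μ₀ y|)) := by gcongr
      _ = _ := by ring
  have hrb := abs_weightedPrimitive_dual_le h h₀ hΛ hF x z
  have hδ := integral_abs_sub_nonneg μ μ₀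
  have hN : 0 ≤ (besovDualNorm 1 (fun y => s y - s₀ y)).toReal := ENNReal.toReal_nonneg
  have c1 : (1 + Λ) * (2 * Λ * (Λ * Λ)) ≤ 32 * Λ ^ 4 := by
    have : 0 ≤ Λ ^ 3 := by positivity
    nlinarith
  have c2 : 32 * Λ ^ 2 ≤ 32 * Λ ^ 4 := by
    have : Λ ^ 2 ≤ Λ ^ 4 := pow_le_pow_right₀ hΛ (by norm_num)
    linarith
  rw [split, mul_add]
  exact (abs_add_le _ _).trans (add_le_add (hqb.trans (mul_le_mul_of_nonneg_right c1 hδ))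
    (hrb.trans (mul_le_mul_of_nonneg_right c2 hN)))

lemma UniformlyBounded.abs_weightedPrimitive_le (h : UniformlyBounded Λ μ s)
    (h₀ : UniformlyBounded Λ μ₀ s₀) (hΛ : 1 ≤ Λ) (x z : ℝ) :
    |weightedPrimitive μ₀ (scaleDensity μ s) x z| ≤ 4 * Λ ^ 3 := by
  refine (ReflectedDiffusion.abs_weightedPrimitive_le h₀.abs_density_le
    (h.abs_scaleDensity_le hΛ) x z).trans ?_
  have : 0 ≤ Λ ^ 2 := by positivity
  nlinarith

lemma UniformlyBounded.abs_centredPrimitive_le (h : UniformlyBounded Λ μ s)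
    (h₀ : UniformlyBounded Λ μ₀ s₀) (hΛ : 1 ≤ Λ) (x z : ℝ) :
    |centredPrimitive μ₀ μ s x z| ≤ 8 * Λ ^ 4 := by
  have h1 : |∫ y in (0 : ℝ)..1, μ y * weightedPrimitive μ₀ (scaleDensity μ s) x y|
      ≤ Λ * (4 * Λ ^ 3) := by
    refine abs_integral_unit_le fun y hy => ?_
    rw [abs_mul]
    exact mul_le_mul (h.abs_density_le y hy) (h.abs_weightedPrimitive_le h₀ hΛ x y)
      (abs_nonneg _) (by positivity)
  have h2 : Λ ^ 3 ≤ Λ ^ 4 := pow_le_pow_right₀ hΛ (by norm_num)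
  refine (abs_sub _ _).trans ((add_le_add (h.abs_weightedPrimitive_le h₀ hΛ x z) h1).trans ?_)
  nlinarith

lemma abs_centredPrimitive_sub_le (h : UniformlyBounded Λ μ s)
    (h₀ : UniformlyBounded Λ μ₀ s₀) (hΛ : 1 ≤ Λ)
    (hF : besovDualNorm 1 (fun y => s y - s₀ y) ≠ ⊤) {x : ℝ} (hx : x ∈ Icc (0 : ℝ) 1) (z : ℝ) :
    |centredPrimitive μ₀ μ s x z - centredPrimitive μ₀ μ₀ s₀ x z|
      ≤ 68 * Λ ^ 5 * ((∫ y in (0 : ℝ)..1, |μ y - μ₀ y|)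
        + (besovDualNorm 1 (fun y => s y - s₀ y)).toReal) := by
  have hδ := integral_abs_sub_nonneg μ μ₀
  have hN : 0 ≤ (besovDualNorm 1 (fun y => s y - s₀ y)).toReal := ENNReal.toReal_nonneg
  have hsub := abs_weightedPrimitive_sub_le h h₀ hΛ hF x
  have hδi := intervalIntegrable_abs_density_sub h h₀
  set δ := ∫ y in (0 : ℝ)..1, |μ y - μ₀ y|
  set N := (besovDualNorm 1 (fun y => s y - s₀ y)).toReal
  set k := weightedPrimitive μ₀ (scaleDensity μ s) x
  set k₀ := weightedPrimitive μ₀ (scaleDensity μ₀ s₀) x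
  have hk : ContinuousOn k (Icc 0 1) :=
    continuousOn_weightedPrimitive h₀.continuousOn_density h.continuousOn_scaleDensity hx
  have hk₀ : ContinuousOn k₀ (Icc 0 1) :=
    continuousOn_weightedPrimitive h₀.continuousOn_density h₀.continuousOn_scaleDensity hx
  have i1 : IntervalIntegrable (fun y => μ y * (k y - k₀ y)) volume 0 1 :=
    intervalIntegrable_of_continuousOn_unit (h.continuousOn_density.mul (hk.sub hk₀))
  have i2 : IntervalIntegrable (fun y => (μ y - μ₀ y) * k₀ y) volume 0 1 :=
    intervalIntegrable_of_continuousOn_unit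
      ((h.continuousOn_density.sub h₀.continuousOn_density).mul hk₀)
  have i3 : IntervalIntegrable (fun y => μ y * k y) volume 0 1 :=
    intervalIntegrable_of_continuousOn_unit (h.continuousOn_density.mul hk)
  have i4 : IntervalIntegrable (fun y => μ₀ y * k₀ y) volume 0 1 :=
    intervalIntegrable_of_continuousOn_unit (h₀.continuousOn_density.mul hk₀)
  -- `μ k - μ₀ k₀ = μ (k - k₀) + (μ - μ₀) k₀` in the centring term.
  have split : centredPrimitive μ₀ μ s x z - centredPrimitive μ₀ μ₀ s₀ x z
      = (k z - k₀ z) - ((∫ y in (0 : ℝ)..1, μ y * (k y - k₀ y))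
        + ∫ y in (0 : ℝ)..1, (μ y - μ₀ y) * k₀ y) := by
    have e : (∫ y in (0 : ℝ)..1, μ y * k y) - ∫ y in (0 : ℝ)..1, μ₀ y * k₀ y
        = (∫ y in (0 : ℝ)..1, μ y * (k y - k₀ y)) + ∫ y in (0 : ℝ)..1, (μ y - μ₀ y) * k₀ y := by
      rw [← intervalIntegral.integral_sub i3 i4, ← intervalIntegral.integral_add i1 i2]
      refine intervalIntegral.integral_congr fun y _ => ?_
      ring
    rw [← e]
    simp only [centredPrimitive]
    ring
  have b2 : |∫ y in (0 : ℝ)..1, μ y * (k y - k₀ y)| ≤ Λ * (32 * Λ ^ 4 * (δ + N)) := by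
    refine abs_integral_unit_le fun y hy => ?_
    rw [abs_mul]
    exact mul_le_mul (h.abs_density_le y hy) (hsub y) (abs_nonneg _) (by positivity)
  have b3 : |∫ y in (0 : ℝ)..1, (μ y - μ₀ y) * k₀ y| ≤ δ * (4 * Λ ^ 3) := by
    refine (intervalIntegral.abs_integral_le_integral_abs zero_le_one).trans ?_
    rw [← intervalIntegral.integral_mul_const]
    refine intervalIntegral.integral_mono_on zero_le_one i2.abs (hδi.mul_const _) fun y _ => ?_
    rw [abs_mul]
    exact mul_le_mul_of_nonneg_left (h₀.abs_weightedPrimitive_le h₀ hΛ x y) (abs_nonneg _)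
  have p1 : Λ ^ 4 * (δ + N) ≤ Λ ^ 5 * (δ + N) :=
    mul_le_mul_of_nonneg_right (pow_le_pow_right₀ hΛ (by norm_num)) (by positivity)
  have p2 : Λ ^ 3 * δ ≤ Λ ^ 5 * (δ + N) :=
    mul_le_mul (pow_le_pow_right₀ hΛ (by norm_num)) (by linarith) hδ (by positivity)
  rw [split]
  calc _ ≤ |k z - k₀ z| + |(∫ y in (0 : ℝ)..1, μ y * (k y - k₀ y))
        + ∫ y in (0 : ℝ)..1, (μ y - μ₀ y) * k₀ y| := abs_sub _ _
    _ ≤ 32 * Λ ^ 4 * (δ + N) + (Λ * (32 * Λ ^ 4 * (δ + N)) + δ * (4 * Λ ^ 3)) :=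
      add_le_add (hsub z) ((abs_add_le _ _).trans (add_le_add b2 b3))
    _ ≤ 68 * Λ ^ 5 * (δ + N) := by linarith

/-- The pointwise comparison: the dependence on `x` is uniform, and the one on `z` enters only
through `μ z - μ₀ z`. -/
lemma abs_kernel_sub_le (h : UniformlyBounded Λ μ s) (h₀ : UniformlyBounded Λ μ₀ s₀) (hΛ : 1 ≤ Λ)
    (hF : besovDualNorm 1 (fun y => s y - s₀ y) ≠ ⊤) {x z : ℝ} (hx : x ∈ Icc (0 : ℝ) 1)
    (hz : z ∈ Icc (0 : ℝ) 1) :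
    |μ z / μ₀ z * centredPrimitive μ₀ μ s x z - μ₀ z / μ₀ z * centredPrimitive μ₀ μ₀ s₀ x z|
      ≤ 68 * Λ ^ 5 * (|μ z - μ₀ z| + ((∫ y in (0 : ℝ)..1, |μ y - μ₀ y|)
        + (besovDualNorm 1 (fun y => s y - s₀ y)).toReal)) := by
  have hpos := (h₀.density_pos z hz).ne'
  have e : μ z / μ₀ z * centredPrimitive μ₀ μ s x z - μ₀ z / μ₀ z * centredPrimitive μ₀ μ₀ s₀ x z
      = 1 / μ₀ z * (μ z - μ₀ z) * centredPrimitive μ₀ μ s x z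
        + (centredPrimitive μ₀ μ s x z - centredPrimitive μ₀ μ₀ s₀ x z) := by
    field_simp
    ring
  have b1 : |1 / μ₀ z * (μ z - μ₀ z) * centredPrimitive μ₀ μ s x z|
      ≤ Λ * |μ z - μ₀ z| * (8 * Λ ^ 4) := by
    rw [abs_mul, abs_mul]
    have h1 := h₀.abs_inv_density_le z hz
    have h2 := h.abs_centredPrimitive_le h₀ hΛ x z
    gcongr
  rw [e, mul_add]
  refine (abs_add_le _ _).trans (add_le_add (b1.trans ?_)
    (abs_centredPrimitive_sub_le h h₀ hΛ hF hx z))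
  have : 0 ≤ Λ ^ 5 * |μ z - μ₀ z| := by positivity
  linarith

/-! ### The Hilbert–Schmidt norm -/

lemma memLp_two_density_sub (h : UniformlyBounded Λ μ s) (h₀ : UniformlyBounded Λ μ₀ s₀) :
    MemLp (fun y => μ y - μ₀ y) 2 (volume.restrict (Icc (0 : ℝ) 1)) := by
  have hc := h.continuousOn_density.sub h₀.continuousOn_density
  refine MemLp.of_bound (hc.aestronglyMeasurable measurableSet_Icc) (Λ + Λ) ?_
  refine (ae_restrict_iff' measurableSet_Icc).2 (Filter.Eventually.of_forall fun y hy => ?_)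
  exact (abs_sub _ _).trans (add_le_add (h.abs_density_le y hy) (h₀.abs_density_le y hy))

lemma integral_abs_density_sub_le (h : UniformlyBounded Λ μ s) (h₀ : UniformlyBounded Λ μ₀ s₀) :
    ENNReal.ofReal (∫ y in (0 : ℝ)..1, |μ y - μ₀ y|)
      ≤ eLpNorm (fun y => μ y - μ₀ y) 2 (volume.restrict (Icc (0 : ℝ) 1)) := by
  have hp : IsProbabilityMeasure (volume.restrict (Icc (0 : ℝ) 1)) := ⟨by simp⟩
  have h2 := memLp_two_density_sub h h₀
  have h1 := h2.mono_exponent (p := 1) (by norm_num)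
  calc ENNReal.ofReal (∫ y in (0 : ℝ)..1, |μ y - μ₀ y|)
      = eLpNorm (fun y => μ y - μ₀ y) 1 (volume.restrict (Icc (0 : ℝ) 1)) := by
        rw [intervalIntegral.integral_of_le zero_le_one, ← integral_Icc_eq_integral_Ioc,
          eLpNorm_one_eq_lintegral_enorm,
          ← ofReal_integral_norm_eq_lintegral_enorm (memLp_one_iff_integrable.1 h1)]
        rfl
    _ ≤ _ := eLpNorm_le_eLpNorm_of_exponent_le (by norm_num) h2.1

/-- Integration of the square of the pointwise comparison. -/
lemma lintegral_sq_rpow_half_le {k : ℝ → ℝ → ℝ} {c e : ℝ} {N : ℝ≥0∞}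
    (h₀ : UniformlyBounded Λ μ₀ s₀) (hΛ : 1 ≤ Λ) (hc : 0 ≤ c)
    (he : ENNReal.ofReal e ≤ eLpNorm (fun y => μ y - μ₀ y) 2 (volume.restrict (Icc (0 : ℝ) 1)) + N)
    (he0 : 0 ≤ e)
    (hk : ∀ x ∈ Icc (0 : ℝ) 1, ∀ z ∈ Icc (0 : ℝ) 1, |k x z| ≤ c * (|μ z - μ₀ z| + e)) :
    (∫⁻ x in Icc (0 : ℝ) 1, ∫⁻ z in Icc (0 : ℝ) 1, ENNReal.ofReal (k x z ^ 2 * μ₀ x * μ₀ z))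
      ^ (1 / 2 : ℝ) ≤ ENNReal.ofReal (2 * c * Λ) *
        (eLpNorm (fun y => μ y - μ₀ y) 2 (volume.restrict (Icc (0 : ℝ) 1)) + N) := by
  set δ := eLpNorm (fun y => μ y - μ₀ y) 2 (volume.restrict (Icc (0 : ℝ) 1)) with hδ
  have hsq : ∫⁻ z in Icc (0 : ℝ) 1, ENNReal.ofReal |μ z - μ₀ z| ^ 2 = δ ^ 2 := by
    have := eLpNorm_nnreal_pow_eq_lintegral (μ := volume.restrict (Icc (0 : ℝ) 1))
      (f := fun y => μ y - μ₀ y) (p := 2) two_ne_zero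
    simp only [NNReal.coe_ofNat, ENNReal.rpow_ofNat, Real.enorm_eq_ofReal_abs] at this
    exact this.symm
  have hpt : ∀ x ∈ Icc (0 : ℝ) 1, ∀ z ∈ Icc (0 : ℝ) 1,
      ENNReal.ofReal (k x z ^ 2 * μ₀ x * μ₀ z) ≤ ENNReal.ofReal (2 * c ^ 2 * Λ ^ 2) *
        (ENNReal.ofReal |μ z - μ₀ z| ^ 2 + ENNReal.ofReal e ^ 2) := by
    intro x hx z hz
    rw [← ENNReal.ofReal_pow (abs_nonneg _), ← ENNReal.ofReal_pow he0,
      ← ENNReal.ofReal_add (by positivity) (by positivity), ← ENNReal.ofReal_mul (by positivity)]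
    refine ENNReal.ofReal_le_ofReal ?_
    have h1 := hk x hx z hz
    have h2 : k x z ^ 2 ≤ (c * (|μ z - μ₀ z| + e)) ^ 2 := by
      rw [← sq_abs]
      gcongr
    have h3 : (|μ z - μ₀ z| + e) ^ 2 ≤ 2 * (|μ z - μ₀ z| ^ 2 + e ^ 2) := add_sq_le
    have h4 := h₀.density_le x hx
    have h5 := h₀.density_le z hz
    have h6 := h₀.density_pos x hx
    have h7 := h₀.density_pos z hz
    calc k x z ^ 2 * μ₀ x * μ₀ z ≤ (c * (|μ z - μ₀ z| + e)) ^ 2 * Λ * Λ := by gcongr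
      _ = c ^ 2 * Λ ^ 2 * (|μ z - μ₀ z| + e) ^ 2 := by ring
      _ ≤ c ^ 2 * Λ ^ 2 * (2 * (|μ z - μ₀ z| ^ 2 + e ^ 2)) := by gcongr
      _ = _ := by ring
  have hint : ∫⁻ x in Icc (0 : ℝ) 1, ∫⁻ z in Icc (0 : ℝ) 1,
      ENNReal.ofReal (k x z ^ 2 * μ₀ x * μ₀ z) ≤ (ENNReal.ofReal (2 * c * Λ) * (δ + N)) ^ 2 := by
    have hinner : ∀ x ∈ Icc (0 : ℝ) 1, ∫⁻ z in Icc (0 : ℝ) 1,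
        ENNReal.ofReal (k x z ^ 2 * μ₀ x * μ₀ z) ≤
        ENNReal.ofReal (2 * c ^ 2 * Λ ^ 2) * (δ ^ 2 + ENNReal.ofReal e ^ 2) := by
      intro x hx
      refine (setLIntegral_mono' measurableSet_Icc (hpt x hx)).trans (le_of_eq ?_)
      rw [lintegral_const_mul' _ _ ENNReal.ofReal_ne_top, lintegral_add_right _ measurable_const,
        hsq]
      simp
    refine (setLIntegral_mono' measurableSet_Icc hinner).trans ?_
    calc ∫⁻ _ in Icc (0 : ℝ) 1, ENNReal.ofReal (2 * c ^ 2 * Λ ^ 2) * (δ ^ 2 + ENNReal.ofReal e ^ 2)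
        = ENNReal.ofReal (2 * c ^ 2 * Λ ^ 2) * (δ ^ 2 + ENNReal.ofReal e ^ 2) := by simp
      _ ≤ ENNReal.ofReal (2 * c ^ 2 * Λ ^ 2) * ((δ + N) ^ 2 + (δ + N) ^ 2) := by
        gcongr
        exact le_self_add
      _ = (ENNReal.ofReal (2 * c ^ 2 * Λ ^ 2) * 2) * (δ + N) ^ 2 := by ring
      _ = (ENNReal.ofReal (2 * c * Λ) * (δ + N)) ^ 2 := by
        rw [mul_pow, ← ENNReal.ofReal_pow (by positivity), ← ENNReal.ofReal_ofNat,
          ← ENNReal.ofReal_mul (by positivity)]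
        congr 2
        ring
  refine (ENNReal.rpow_le_rpow hint (by norm_num)).trans (le_of_eq ?_)
  rw [← ENNReal.rpow_natCast, ← ENNReal.rpow_mul]
  norm_num

end Comparison

end ReflectedDiffusion

theorem mainTheorem10 (D d : ℝ) (hD : 0 < D) (hd : 0 < d) :
    ∃ C : ℝ≥0, 0 < C ∧
      ∀ σ b σ₀ b₀ : ℝ → ℝ,
        (σ, b) ∈ ReflectedDiffusion.Theta D d →
        (σ₀, b₀) ∈ ReflectedDiffusion.Theta D d →
        ∀ μ₀ : ℝ → ℝ, μ₀ = ReflectedDiffusion.invDensity σ₀ b₀ →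
          (∫⁻ x in Icc (0 : ℝ) 1, ∫⁻ z in Icc (0 : ℝ) 1,
              ENNReal.ofReal
                ((ReflectedDiffusion.greenKernel μ₀ σ b x z
                    - ReflectedDiffusion.greenKernel μ₀ σ₀ b₀ x z) ^ 2 * μ₀ x * μ₀ z))
              ^ (1 / 2 : ℝ)
            ≤ C * eLpNorm (fun x => ReflectedDiffusion.invDensity σ b x - μ₀ x) 2
                  (volume.restrict (Icc (0 : ℝ) 1))
              + C * ReflectedDiffusion.besovDualNorm 1
                  (fun x => 1 / σ x ^ 2 - 1 / σ₀ x ^ 2)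
              + C * ReflectedDiffusion.besovDualNorm 2 (fun x => b x - b₀ x) := by
  open ReflectedDiffusion in
  obtain ⟨Λ, hΛ, hΛb⟩ := exists_uniformlyBounded hD hd
  have hC : 0 < 2 * (68 * Λ ^ 5) * Λ := by positivity
  refine ⟨(2 * (68 * Λ ^ 5) * Λ).toNNReal, Real.toNNReal_pos.2 hC, ?_⟩
  rintro σ b σ₀ b₀ hσ hσ₀ μ₀ rfl
  have h := hΛb σ b hσ
  have h₀ := hΛb σ₀ b₀ hσ₀
  by_cases hF : besovDualNorm 1 (fun x => 1 / σ x ^ 2 - 1 / σ₀ x ^ 2) = ⊤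
  · rw [hF, ENNReal.mul_top (by simpa using hC)]
    simp
  -- The first two terms already dominate the left-hand side.
  refine le_trans ?_ le_self_add
  rw [← mul_add]
  have hμ₀ : ∀ y ∈ Icc (0 : ℝ) 1, invDensity σ₀ b₀ y ≠ 0 := fun y hy => (h₀.density_pos y hy).ne'
  refine lintegral_sq_rpow_half_le (e := (∫ y in (0 : ℝ)..1, |invDensity σ b y
    - invDensity σ₀ b₀ y|) + (besovDualNorm 1 (fun x => 1 / σ x ^ 2 - 1 / σ₀ x ^ 2)).toReal)
    h₀ hΛ (by positivity) ?_ ?_ ?_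
  · rw [ENNReal.ofReal_add (integral_abs_sub_nonneg _ _) ENNReal.toReal_nonneg,
      ENNReal.ofReal_toReal hF]
    exact add_le_add_left (integral_abs_density_sub_le h h₀) _
  · exact add_nonneg (integral_abs_sub_nonneg _ _) ENNReal.toReal_nonneg
  · intro x hx z hz
    rw [greenKernel_eq hd hσ hμ₀, greenKernel_eq hd hσ₀ hμ₀]
    exact abs_kernel_sub_le h h₀ hΛ hF hx hz
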